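/- Let $N\ge 2$ and $d\ge N$ be integers, and let $\mathbb R^N$ carry its Euclidean structure. For every $s\in\mathbb N$ let $\mathbb H^{(s)}=\{\ell^{(s)}_1,\dots,\ell^{(s)}_d\}$ be a family of $d$ distinct hyperplanes $\ell^{(s)}_i=\{x\in\mathbb R^N:\langle \mathbf n^{(s)}_i,x\rangle=c^{(s)}_i\}$, $\|\mathbf n^{(s)}_i\|=1$, in general position: any $N$ of them, forming a subfamily $H$, meet in exactly one point $\vartheta_H$, and $\vartheta_H\neq\vartheta_{H'}$ for $H\ne H'$. Let $\Theta^{(s)}=\{\vartheta_H : H\subset\mathbb H^{(s)},\ |H|=N\}$ be the corresponding Chung–Yao lattice, and put $\|\Theta^{(s)}\|=\max\{\|\vartheta\|:\vartheta\in\Theta^{(s)}\}$. Assume (C1) $\|\Theta^{(s)}\|\to 0$ as $s\to\infty$; (C2) there is $\delta>0$ such that for all $s$ and all $1\le i_1<\dots<i_N\le d$ the volume of the parallelotope spanned by $\mathbf n^{(s)}_{i_1},\dots,\mathbf n^{(s)}_{i_N}$ is at least $\delta$. Then every $\Theta^{(s)}$ is an interpolation lattice of degree $d-N$, that is, for every function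 $f$ there is exactly one real polynomial $\mathbf L[\Theta^{(s)};f]$ in $N$ variables of total degree at most $d-N$ which coincides with $f$ on $\Theta^{(s)}$. Moreover, let $R>0$, let $B(0,R)$ be the closed Euclidean ball of centre $0$ and radius $R$, and let $\mathbf T_0^{d-N}(f)$ denote the Taylor polynomial of $f$ at $0$ to the order $d-N$. There is a constant $C$ such that for every $s$ with $\Theta^{(s)}\subset B(0,R)$ (which by (C1) holds for all large $s$), every open set $\Omega\supset B(0,R)$ and every real function $f\in C^{d-N+2}(\Omega)$, $$\max_{x\in B(0,R)}\bigl|\mathbf L[\Theta^{(s)};f](x)-\mathbf T^{d-N}_0(f)(x)\bigr|\le C\,\|\Theta^{(s)}\|\Bigl(\max_{a\in B(0,R)}\|f^{(d-N+1)}(a)\|+\max_{a\in B(0,R)}\|f^{(d-N+2)}(a)\|\Bigr),$$ where $f^{(k)}(a)$ is the $k$-th total derivative and $\|\cdot\|$ the usual norm of a multilinear form. In particular, $C$ depends neither on $f$ nor on $s$. -/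

import Mathlib

open MeasureTheory

namespace ChungYao

noncomputable section

/-- `ℝ^N` with its canonical Euclidean structure. -/
abbrev Space (N : ℕ) : Type := EuclideanSpace ℝ (Fin N)

/-- The hyperplane `{x : ⟨n, x⟩ = c}`. -/
def hyperplane {N : ℕ} (n : Space N) (c : ℝ) : Set (Space N) :=
  {x | inner ℝ n x = c}

/-- The intersection of the hyperplanes `⟨n i, ·⟩ = c i` whose index lies in `H`. -/
def flat {N d : ℕ} (n : Fin d → Space N) (c : Fin d → ℝ) (H : Finset (Fin d)) : Set (Space N) :=
  ⋂ i ∈ H, hyperplane (n i) (c i)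

/-- The `d` hyperplanes `⟨n i, ·⟩ = c i` of `ℝ^N` are distinct and in general position: any `N`
of them meet in exactly one point, and different choices of `N` of them give different points. -/
structure InGeneralPosition {N d : ℕ} (n : Fin d → Space N) (c : Fin d → ℝ) : Prop where
  distinct : Function.Injective fun i => hyperplane (n i) (c i)
  meet_in_point : ∀ H : Finset (Fin d), H.card = N → ∃ ϑ : Space N, flat n c H = {ϑ}
  points_distinct : Set.InjOn (flat n c) {H : Finset (Fin d) | H.card = N}

/-- The Chung-Yao lattice: the points at which `N` of the hyperplanes meet. -/
def lattice {N d : ℕ} (n : Fin d → Space N) (c : Fin d → ℝ) : Set (Space N) :=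
  {x | ∃ H : Finset (Fin d), H.card = N ∧ x ∈ flat n c H}

/-- The supremum of `g` on `B` (a maximum when `B` is nonempty and finite, or nonempty and compact
with `g` continuous on it). -/
def maxOn {α : Type*} (B : Set α) (g : α → ℝ) : ℝ := sSup (g '' B)

/-- The maximum of the Euclidean norms of the points of a (finite) lattice. -/
def latticeNorm {N : ℕ} (A : Set (Space N)) : ℝ := maxOn A fun ϑ => ‖ϑ‖

/-- The `N`-dimensional volume of the parallelotope spanned by `N` vectors of `ℝ^N`. -/
def vol {N : ℕ} (v : Fin N → Space N) : ℝ := (volume (parallelepiped v)).toReal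

/-- The value at `x` of a polynomial in `N` variables. -/
def evalAt {N : ℕ} (p : MvPolynomial (Fin N) ℝ) (x : Space N) : ℝ :=
  MvPolynomial.eval (fun i => x i) p

/-- `p` is a polynomial of degree at most `k` which coincides with `f` on `A`. -/
def Interpolates {N : ℕ} (k : ℕ) (A : Set (Space N)) (f : Space N → ℝ)
    (p : MvPolynomial (Fin N) ℝ) : Prop :=
  p ∈ MvPolynomial.restrictTotalDegree (Fin N) ℝ k ∧ ∀ a ∈ A, evalAt p a = f a

/-- `A` is an interpolation lattice of degree `k`. -/
def IsInterpolationLattice {N : ℕ} (k : ℕ) (A : Set (Space N)) : Prop :=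
  ∀ f : Space N → ℝ, ∃! p : MvPolynomial (Fin N) ℝ, Interpolates k A f p

open Classical in
/-- The Lagrange interpolation polynomial `L[A; f]` of degree at most `k`; it is the unique
polynomial that interpolates `f` when `A` is an interpolation lattice of degree `k`. -/
def lagrange {N : ℕ} (k : ℕ) (A : Set (Space N)) (f : Space N → ℝ) : MvPolynomial (Fin N) ℝ :=
  if h : ∃ p : MvPolynomial (Fin N) ℝ, Interpolates k A f p then h.choose else 0

/-- The Taylor polynomial of `f` at the origin to the order `k`, as a function. -/
def taylorAtZero {N : ℕ} (k : ℕ) (f : Space N → ℝ) (x : Space N) : ℝ :=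
  ∑ j ∈ Finset.range (k + 1), ((j.factorial : ℝ))⁻¹ * iteratedFDeriv ℝ j f 0 (fun _ => x)

end

end ChungYao

/-! Put k = d - N and r = ‖Θ‖. Interpolation of degree k reproduces the Taylor polynomial T, so L f
- T = L g with g = f - T. If M bounds the derivative of f of order k + 1, the derivatives of g of
order j ≤ k are at most M r^(k+1-j) on B(0,r), where all nodes lie
(`norm_iteratedFDeriv_sub_taylorSum_le`); since j ≤ k, this carries a factor r. It remains to bound
L g on B(0,R) by these derivatives, uniformly in the lattice although the nodes collapse
(`exists_interpolant_bound`).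

For this the hyperplanes are added one at a time, as in Newton's formula. A new hyperplane brings
the vertices lying on it. Each such vertex lies on the line cut out by some family K of N - 1 old
hyperplanes, and is corrected by a multiple α_K of the product of the affine forms of the old
hyperplanes outside K. On that line the old interpolant is a one-variable interpolant, whose error
is a derivative times a product of parameter differences. By (C2) this product is at most a power of
1/δ times the same product of affine forms, so α_K stays bounded however close the nodes are. -/

namespace ChungYao

/-! ### Lagrange interpolation error in one variable. -/

/-- The iterated form of Rolle's theorem. -/
theorem exists_iteratedDeriv_eq_zero {s : Set ℝ} (hs : s.OrdConnected) (m : ℕ)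
    {h : ℝ → ℝ} (hh : ContDiff ℝ m h)
    (x : Fin (m + 1) → ℝ) (hx : StrictMono x) (hmem : ∀ i, x i ∈ s)
    (hzero : ∀ i, h (x i) = 0) : ∃ ξ ∈ s, iteratedDeriv m h ξ = 0 := by
  induction m generalizing h with
  | zero => exact ⟨x 0, hmem 0, by simpa using hzero 0⟩
  | succ m ih =>
    have rolle (i : Fin (m + 1)) :
        ∃ y ∈ Set.Ioo (x i.castSucc) (x i.succ), deriv h y = 0 :=
      exists_deriv_eq_zero (hx i.castSucc_lt_succ) hh.continuous.continuousOn
        ((hzero _).trans (hzero _).symm)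
    choose y hy hy0 using rolle
    have hh' : ContDiff ℝ m (deriv h) := by
      have : ContDiff ℝ ((m : WithTop ℕ∞) + 1) h := by exact_mod_cast hh
      exact (contDiff_succ_iff_deriv.1 this).2.2
    obtain ⟨ξ, hξ, hξ0⟩ := ih hh' y
      (Fin.strictMono_iff_lt_succ.2 fun i => by
        have h1 := (hy i.castSucc).2
        have h2 := (hy i.succ).1
        rw [Fin.succ_castSucc] at h1
        exact h1.trans h2)
      (fun i => hs.out (hmem _) (hmem _) (Set.Ioo_subset_Icc_self (hy i))) hy0
    exact ⟨ξ, hξ, by rw [iteratedDeriv_succ']; exact hξ0⟩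

open Polynomial in
theorem iteratedDeriv_polynomial_eval (P : ℝ[X]) (m : ℕ) :
    iteratedDeriv m (fun t => P.eval t) = fun t => (derivative^[m] P).eval t := by
  induction m with
  | zero => simp
  | succ m ih =>
    rw [iteratedDeriv_succ, ih, Function.iterate_succ_apply']
    ext t
    exact Polynomial.deriv _

open Polynomial in
/-- The error of Lagrange interpolation in one variable. -/
theorem exists_interpolation_error_eq {κ : Type*} {s : Set ℝ} (hs : s.OrdConnected)
    {I : Finset κ} {t : κ → ℝ}
    {g : ℝ → ℝ} (hg : ContDiff ℝ I.card g) (ht : Set.InjOn t I) {q : ℝ[X]}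
    (hq : q.degree < I.card) (hqt : ∀ i ∈ I, q.eval (t i) = g (t i)) {τ : ℝ}
    (hτ : ∀ i ∈ I, t i ≠ τ) (hmem : ∀ i ∈ I, t i ∈ s) (hτmem : τ ∈ s) :
    ∃ ξ ∈ s, g τ - q.eval τ
      = iteratedDeriv I.card g ξ / (I.card.factorial : ℝ) * ∏ i ∈ I, (τ - t i) := by
  classical
  set k := I.card with hk
  set w : ℝ[X] := ∏ i ∈ I, (X - C (t i)) with hw
  have hwmonic : w.Monic := monic_prod_of_monic _ _ fun i _ => monic_X_sub_C _
  have hwdeg : w.natDegree = k := by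
    rw [hw, natDegree_prod_of_monic _ _ fun i _ => monic_X_sub_C _]; simp [hk]
  have hweval (z : ℝ) : w.eval z = ∏ i ∈ I, (z - t i) := by simp [hw, eval_prod]
  have hw0 : w.eval τ ≠ 0 := by
    rw [hweval, Finset.prod_ne_zero_iff]
    exact fun i hi => sub_ne_zero.2 (hτ i hi).symm
  -- `lam` makes g - (q + lam w) vanish at τ as well as at the k nodes: k + 1 zeros, enough for k
  -- uses of Rolle's theorem.
  set lam : ℝ := (g τ - q.eval τ) / w.eval τ with hlam
  set P : ℝ[X] := q + C lam * w with hP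
  have hPdeg : P.natDegree ≤ k := by
    refine natDegree_add_le_of_degree_le (natDegree_le_of_degree_le hq.le) ?_
    exact (natDegree_C_mul_le _ _).trans hwdeg.le
  have hPcoeff : P.coeff k = lam := by
    have h1 : q.coeff k = 0 := coeff_eq_zero_of_degree_lt hq
    have h2 : w.coeff k = 1 := by rw [← hwdeg]; exact hwmonic
    simp [hP, h1, h2]
  have hPder : derivative^[k] P = C ((k.factorial : ℝ) * lam) := by
    have hd : (derivative^[k] P).natDegree ≤ 0 :=
      (natDegree_iterate_derivative P k).trans (by omega)
    rw [eq_C_of_natDegree_le_zero hd, coeff_iterate_derivative]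
    simp [hPcoeff, Nat.descFactorial_self]
  set h : ℝ → ℝ := fun z => g z - P.eval z with hh
  have hPc : ContDiff ℝ k fun z => P.eval z := by
    simpa using contDiff_aeval (𝕜 := ℝ) P k
  have hroot : ∀ z ∈ insert τ (I.image t), h z = 0 := by
    intro z hz
    rcases Finset.mem_insert.1 hz with rfl | hz
    · simp only [hh, hP, eval_add, eval_mul, eval_C, hlam]; field_simp; ring
    · obtain ⟨i, hi, rfl⟩ := Finset.mem_image.1 hz
      have : w.eval (t i) = 0 := by
        rw [hweval]; exact Finset.prod_eq_zero hi (sub_self _)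
      simp [hh, hP, this, hqt i hi]
  have hcard : (insert τ (I.image t)).card = k + 1 := by
    rw [Finset.card_insert_of_notMem, Finset.card_image_of_injOn ht]
    simpa using hτ
  have hsub : ∀ z ∈ insert τ (I.image t), z ∈ s := by
    intro z hz
    rcases Finset.mem_insert.1 hz with rfl | hz
    · exact hτmem
    · obtain ⟨i, hi, rfl⟩ := Finset.mem_image.1 hz
      exact hmem i hi
  obtain ⟨ξ, hξ, hξ0⟩ := exists_iteratedDeriv_eq_zero hs k (hg.sub hPc)
    (Finset.orderEmbOfFin _ hcard) (OrderEmbedding.strictMono _)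
    (fun i => hsub _ (Finset.orderEmbOfFin_mem _ _ _))
    (fun i => hroot _ (Finset.orderEmbOfFin_mem _ _ _))
  refine ⟨ξ, hξ, ?_⟩
  have hder : iteratedDeriv k g ξ = (k.factorial : ℝ) * lam := by
    have := (iteratedDeriv_sub (x := ξ) hg.contDiffAt hPc.contDiffAt).symm.trans hξ0
    rw [iteratedDeriv_polynomial_eval, hPder] at this
    simp only [eval_C] at this
    linarith
  rw [hder, ← hweval, mul_div_cancel_left₀ _ (by positivity), hlam, div_mul_cancel₀ _ hw0]

/-! ### Derivatives of the Taylor remainder. -/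

section Taylor

variable {E : Type} {F : Type} [NormedAddCommGroup E] [NormedSpace ℝ E]
  [NormedAddCommGroup F] [NormedSpace ℝ F]

theorem contDiff_fderiv_of_succ {m : ℕ} {f : E → F} (hf : ContDiff ℝ (m + 1 : ℕ) f) :
    ContDiff ℝ m (fderiv ℝ f) :=
  hf.fderiv_right (by norm_cast)

theorem iteratedFDeriv_diag_succ (j : ℕ) (f : E → F) (a x : E) :
    iteratedFDeriv ℝ (j + 1) f a (fun _ => x) = iteratedFDeriv ℝ j (fderiv ℝ f) a (fun _ => x) x :=
  iteratedFDeriv_succ_apply_right _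

/-- The second derivative may be flipped under an iterated derivative. -/
theorem iteratedFDeriv_fderiv_fderiv_symm {j : ℕ} {f : E → F} (hf : ContDiff ℝ (j + 2 : ℕ) f)
    (a : E) (w : Fin j → E) (u v : E) :
    iteratedFDeriv ℝ j (fderiv ℝ (fderiv ℝ f)) a w u v
      = iteratedFDeriv ℝ j (fderiv ℝ (fderiv ℝ f)) a w v u := by
  have hD : ContDiff ℝ j (fderiv ℝ (fderiv ℝ f)) :=
    contDiff_fderiv_of_succ (contDiff_fderiv_of_succ hf)
  -- Symmetry says that the second derivative is fixed by the flip, a continuous linear map, which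
  -- commutes with iterated differentiation.
  set L : (E →L[ℝ] E →L[ℝ] F) →L[ℝ] (E →L[ℝ] E →L[ℝ] F) :=
    (ContinuousLinearMap.flipₗᵢ ℝ E E F).toContinuousLinearEquiv.toContinuousLinearMap with hL
  have hsymm : L ∘ fderiv ℝ (fderiv ℝ f) = fderiv ℝ (fderiv ℝ f) := by
    ext y p q
    have : ContDiffAt ℝ (j + 2 : ℕ) f y := hf.contDiffAt
    refine (this.isSymmSndFDerivAt ?_).eq q p
    simp only [minSmoothness_of_isRCLikeNormedField]
    exact_mod_cast Nat.le_add_left 2 j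
  have h := L.iteratedFDeriv_comp_left (G := E →L[ℝ] E →L[ℝ] F) (x := a) (i := j) hD.contDiffAt le_rfl
  rw [hsymm] at h
  exact DFunLike.congr_fun (DFunLike.congr_fun (DFunLike.congr_fun h w) u) v

/-- Each of the j + 1 slots contributes the same term. In the induction the product rule puts the
increment in the wrong one of the last two slots, and symmetry moves it back. `F` varies because the
induction passes from f to its derivative. -/
theorem hasFDerivAt_iteratedFDeriv_diag (j : ℕ) {F : Type} [NormedAddCommGroup F]
    [NormedSpace ℝ F] {f : E → F} (hf : ContDiff ℝ (j + 1 : ℕ) f) (a x : E) :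
    HasFDerivAt (fun y => iteratedFDeriv ℝ (j + 1) f a (fun _ => y))
      ((j + 1 : ℝ) • iteratedFDeriv ℝ j (fderiv ℝ f) a (fun _ => x)) x := by
  induction j generalizing F with
  | zero =>
    simp only [iteratedFDeriv_diag_succ, iteratedFDeriv_zero_apply]
    simpa using (fderiv ℝ f a).hasFDerivAt
  | succ j ih =>
    have key := (ih (contDiff_fderiv_of_succ hf)).clm_apply (hasFDerivAt_id x)
    simp only [iteratedFDeriv_diag_succ (j + 1) f]
    refine key.congr_fderiv ?_
    ext v
    simp only [add_apply, ContinuousLinearMap.comp_apply,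
      ContinuousLinearMap.flip_apply, smul_apply, id, ContinuousLinearMap.id_apply]
    rw [iteratedFDeriv_fderiv_fderiv_symm hf, ← iteratedFDeriv_diag_succ j (fderiv ℝ f)]
    push_cast
    module

/-- The Taylor polynomial of order `k` at the origin of a vector-valued function. -/
noncomputable def taylorSum (k : ℕ) (f : E → F) (x : E) : F :=
  ∑ j ∈ Finset.range (k + 1), ((j.factorial : ℝ))⁻¹ • iteratedFDeriv ℝ j f 0 (fun _ => x)

theorem contDiff_taylorSum (k : ℕ) (f : E → F) {m : WithTop ℕ∞} :
    ContDiff ℝ m (taylorSum k f) := by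
  refine ContDiff.sum fun j _ => contDiff_const.smul ?_
  exact (iteratedFDeriv ℝ j f 0).contDiff.comp (contDiff_pi.2 fun _ => contDiff_id)

theorem taylorSum_zero_right (k : ℕ) (f : E → F) : taylorSum k f 0 = f 0 := by
  rw [taylorSum, Finset.sum_eq_single 0]
  · simp
  · intro j _ hj
    have : Nonempty (Fin j) := ⟨⟨0, Nat.pos_of_ne_zero hj⟩⟩
    rw [(iteratedFDeriv ℝ j f 0).map_coord_zero (Classical.arbitrary (Fin j)) rfl, smul_zero]
  · simp

/-- Hence the derivative of a remainder of order k + 1 is a remainder of order k, which drives the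
induction on the order. -/
theorem fderiv_taylorSum_succ {k : ℕ} {f : E → F} (hf : ContDiff ℝ (k + 1 : ℕ) f) :
    fderiv ℝ (taylorSum (k + 1) f) = taylorSum k (fderiv ℝ f) := by
  ext1 x
  apply HasFDerivAt.fderiv
  have heq : taylorSum (k + 1) f = fun y => (∑ j ∈ Finset.range (k + 1),
      (((j + 1).factorial : ℝ))⁻¹ • iteratedFDeriv ℝ (j + 1) f 0 (fun _ => y)) + f 0 := by
    ext1 y
    rw [taylorSum, Finset.sum_range_succ']
    simp
  rw [heq]
  refine HasFDerivAt.add_const _ ?_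
  unfold taylorSum
  refine HasFDerivAt.fun_sum fun j hj => ?_
  have hj' : j + 1 ≤ k + 1 := by simpa using hj
  have h := (hasFDerivAt_iteratedFDeriv_diag j (hf.of_le (by exact_mod_cast hj')) 0 x).const_smul
    (((j + 1).factorial : ℝ))⁻¹
  refine h.congr_fderiv ?_
  rw [smul_smul, Nat.factorial_succ]
  congr 1
  push_cast
  field_simp

theorem fderiv_taylorSum_zero (f : E → F) : fderiv ℝ (taylorSum 0 f) = 0 := by
  have : taylorSum 0 f = fun _ => f 0 := by
    ext1 y
    simp [taylorSum]
  rw [this]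
  ext1 x
  simp

theorem fderiv_sub_taylorSum {k : ℕ} {f : E → F} (hf : Differentiable ℝ f) :
    fderiv ℝ (f - taylorSum k f) = fderiv ℝ f - fderiv ℝ (taylorSum k f) := by
  ext1 x
  exact fderiv_sub (hf x) ((contDiff_taylorSum (m := 1) k f).differentiable one_ne_zero x)

/-- Mean value inequality from the origin, where the remainder vanishes; each use gains one factor
r. -/
theorem norm_sub_taylorSum_le {k : ℕ} {f : E → F} (hf : Differentiable ℝ f) {r B : ℝ}
    (hr : 0 ≤ r)
    (hB : ∀ b ∈ Metric.closedBall (0 : E) r, ‖fderiv ℝ (f - taylorSum k f) b‖ ≤ B)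
    {a : E} (ha : a ∈ Metric.closedBall (0 : E) r) : ‖(f - taylorSum k f) a‖ ≤ B * r := by
  have h0 : (0 : E) ∈ Metric.closedBall (0 : E) r := by simpa using hr
  have h := (convex_closedBall (0 : E) r).norm_image_sub_le_of_norm_fderiv_le (𝕜 := ℝ)
    (fun b _ => (hf.sub ((contDiff_taylorSum (m := 1) k f).differentiable one_ne_zero)) b) hB h0 ha
  have hz : (f - taylorSum k f) 0 = 0 := by simp [taylorSum_zero_right]
  rw [hz, sub_zero, sub_zero] at h
  have hB0 : 0 ≤ B := (norm_nonneg _).trans (hB 0 h0)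
  exact h.trans (mul_le_mul_of_nonneg_left (by simpa using ha) hB0)

/-- The derivatives of the Taylor remainder are small near the origin. -/
theorem norm_iteratedFDeriv_sub_taylorSum_le (k : ℕ) {F : Type} [NormedAddCommGroup F]
    [NormedSpace ℝ F] {f : E → F} (hf : ContDiff ℝ (k + 1 : ℕ) f) {r M : ℝ} (hr : 0 ≤ r)
    (hM : ∀ a ∈ Metric.closedBall (0 : E) r, ‖iteratedFDeriv ℝ (k + 1) f a‖ ≤ M)
    (j : ℕ) (hj : j ≤ k) (a : E) (ha : a ∈ Metric.closedBall (0 : E) r) :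
    ‖iteratedFDeriv ℝ j (f - taylorSum k f) a‖ ≤ M * r ^ (k + 1 - j) := by
  induction k generalizing F j a with
  | zero =>
    have hdiff : Differentiable ℝ f := hf.differentiable (by simp)
    obtain rfl : j = 0 := by omega
    rw [norm_iteratedFDeriv_zero]
    refine (norm_sub_taylorSum_le hdiff hr (B := M) (fun b hb => ?_) ha).trans (by simp)
    rw [fderiv_sub_taylorSum hdiff, fderiv_taylorSum_zero, sub_zero,
      ← norm_iteratedFDeriv_one (𝕜 := ℝ)]
    exact hM b hb
  | succ k ih =>
    have hdiff : Differentiable ℝ f := hf.differentiable (by norm_cast)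
    have hstep (i : ℕ) (hi : i ≤ k) (b : E) (hb : b ∈ Metric.closedBall (0 : E) r) :
        ‖iteratedFDeriv ℝ i (fderiv ℝ (f - taylorSum (k + 1) f)) b‖ ≤ M * r ^ (k + 1 - i) := by
      rw [fderiv_sub_taylorSum hdiff, fderiv_taylorSum_succ (hf.of_le (by norm_cast; omega))]
      exact ih (contDiff_fderiv_of_succ hf)
        (fun c hc => by rw [norm_iteratedFDeriv_fderiv]; exact hM c hc) i hi b hb
    cases j with
    | zero =>
      rw [norm_iteratedFDeriv_zero]
      refine (norm_sub_taylorSum_le hdiff hr (B := M * r ^ (k + 1)) (fun b hb => ?_) ha).trans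
        (by rw [mul_assoc, ← pow_succ]; simp)
      simpa using hstep 0 (Nat.zero_le _) b hb
    | succ i =>
      rw [← norm_iteratedFDeriv_fderiv, Nat.add_sub_add_right]
      exact hstep i (by omega) a ha

end Taylor

/-! ### Volumes of normals and directions of lines. -/

theorem abs_volumeForm_eq_vol {N : ℕ} [Fact (Module.finrank ℝ (Space N) = N)]
    (o : Orientation ℝ (Space N) (Fin N)) (v : Fin N → Space N) : |o.volumeForm v| = vol v := by
  rw [vol, ← o.measure_eq_volume, AlternatingMap.measure_parallelepiped,
    ENNReal.toReal_ofReal (abs_nonneg _)]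

/-- (C2) concerns increasing indices only, whereas an index placed in front of K need not keep the
order; a parallelepiped ignores permutations. -/
theorem exists_orderEmbedding_vol_eq {N d : ℕ} (n : Fin d → Space N) {e : Fin N → Fin d}
    (he : Function.Injective e) :
    ∃ i : Fin N ↪o Fin d, vol (fun j => n (e j)) = vol (fun j => n (i j)) := by
  classical
  have hcard : (Finset.univ.image e).card = N := by
    rw [Finset.card_image_of_injective _ he, Finset.card_univ, Fintype.card_fin]
  set i := (Finset.univ.image e).orderEmbOfFin hcard
  have hrange (j : Fin N) : ∃ l, i l = e j := by
    have : e j ∈ Set.range i := by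
      rw [Finset.range_orderEmbOfFin]
      simp
    exact this
  choose σ hσ using hrange
  have hσinj : Function.Injective σ := fun a b hab => he (by rw [← hσ a, ← hσ b, hab])
  have hσbij : Function.Bijective σ := Finite.injective_iff_bijective.1 hσinj
  refine ⟨i, ?_⟩
  have : (fun j => n (e j)) = (fun j => n (i j)) ∘ Equiv.ofBijective σ hσbij := by
    ext1 j
    simp [hσ]
  rw [vol, this, parallelepiped_comp_equiv, vol]

/-- A direction of the line cut out by the hyperplanes with index in `K`, transverse to all the
other hyperplanes. -/
theorem exists_line_direction {N d : ℕ} {n : Fin d → Space N} (hunit : ∀ i, ‖n i‖ = 1) {δ : ℝ}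
    (hδ : ∀ i : Fin N ↪o Fin d, δ ≤ vol (fun j => n (i j))) {K : Finset (Fin d)}
    (hK : K.card + 1 = N) :
    ∃ u : Space N, ‖u‖ ≤ 1 ∧ (∀ j ∈ K, inner ℝ (n j) u = 0) ∧
      ∀ i ∉ K, δ ≤ |inner ℝ (n i) u| := by
  obtain ⟨m, hm⟩ : ∃ m, m = K.card := ⟨_, rfl⟩
  rw [← hm] at hK
  subst hK
  have : Fact (Module.finrank ℝ (Space (m + 1)) = m + 1) := ⟨finrank_euclideanSpace_fin⟩
  set o : Orientation ℝ (Space (m + 1)) (Fin (m + 1)) :=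
    (EuclideanSpace.basisFun (Fin (m + 1)) ℝ).toBasis.orientation
  set κ : Fin m ↪o Fin d := K.orderEmbOfFin hm.symm with hκ
  set w : Fin m → Space (m + 1) := fun j => n (κ j) with hw
  -- The vector u representing φ is the generalized cross product of the normals in K: ⟨v, u⟩ is the
  -- volume form of (v, w).
  let φ : Space (m + 1) →ₗ[ℝ] ℝ :=
    { toFun := fun v => o.volumeForm (Matrix.vecCons v w)
      map_add' := fun x y => by
        have := congrArg (fun T => T w) (o.volumeForm.curryLeft.map_add x y)
        exact this
      map_smul' := fun r x => by
        have := congrArg (fun T => T w) (o.volumeForm.curryLeft.map_smul r x)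
        exact this }
  set u := (InnerProductSpace.toDual ℝ (Space (m + 1))).symm (LinearMap.toContinuousLinearMap φ)
  have hu (v : Space (m + 1)) : inner ℝ v u = o.volumeForm (Matrix.vecCons v w) := by
    rw [real_inner_comm]
    exact InnerProductSpace.toDual_symm_apply
  have hκmem (j : Fin m) : κ j ∈ K := Finset.orderEmbOfFin_mem _ _ _
  refine ⟨u, ?_, ?_, ?_⟩
  -- Hadamard's inequality for (u, w), all vectors of w being unit vectors.
  · have h1 : ‖u‖ ^ 2 ≤ ‖u‖ := by
      rw [← real_inner_self_eq_norm_sq, hu]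
      refine (le_abs_self _).trans ((o.abs_volumeForm_apply_le _).trans ?_)
      rw [Fin.prod_univ_succ]
      simp [hw, hunit]
    nlinarith [norm_nonneg u]
  · intro j hj
    have : j ∈ Set.range κ := by
      rw [hκ, Finset.range_orderEmbOfFin]
      exact hj
    obtain ⟨l, rfl⟩ := this
    rw [hu]
    exact o.volumeForm.map_eq_zero_of_eq _ (i := 0) (j := l.succ) (by simp [hw])
      (Fin.succ_ne_zero l).symm
  · intro i hi
    have hinj : Function.Injective (Fin.cons i κ : Fin (m + 1) → Fin d) := by
      rw [Fin.cons_injective_iff]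
      refine ⟨?_, κ.injective⟩
      rintro ⟨l, hl⟩
      exact hi (hl ▸ hκmem l)
    obtain ⟨e, he⟩ := exists_orderEmbedding_vol_eq n hinj
    have hcons : (Matrix.vecCons (n i) w) = fun j => n ((Fin.cons i κ : Fin (m + 1) → Fin d) j) := by
      ext1 j
      refine Fin.cases ?_ (fun l => ?_) j <;> simp [hw]
    rw [hu, abs_volumeForm_eq_vol, hcons, he]
    exact hδ e

/-! ### Unisolvence of the Chung–Yao lattice. -/

section Polynomials

open MvPolynomial

variable {N d : ℕ}

/-- A slack exponent turns degree at most k in N variables into degree exactly k in N + 1 variables.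
-/
theorem card_degree_le (N k : ℕ) :
    Nat.card {m : Fin N →₀ ℕ | (m.sum fun _ e => e) ≤ k} ≤ (N + k).choose k := by
  have hcard := Finset.card_finsuppAntidiag_nat_eq_choose
    (s := (Finset.univ : Finset (Fin (N + 1)))) k
  rw [Finset.card_univ, Fintype.card_fin, show N + 1 + k - 1 = N + k by omega] at hcard
  rw [← hcard, ← Fintype.card_coe, ← Nat.card_eq_fintype_card]
  have hmem (m : Fin N →₀ ℕ) (hm : (m.sum fun _ e => e) ≤ k) :
      Finsupp.cons (k - m.sum fun _ e => e) m ∈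
        Finset.finsuppAntidiag (Finset.univ : Finset (Fin (N + 1))) k := by
    rw [Finset.mem_finsuppAntidiag]
    refine ⟨?_, Finset.subset_univ _⟩
    rw [Fin.sum_univ_succ]
    simp only [Finsupp.cons_zero, Finsupp.cons_succ]
    rw [Finsupp.sum_fintype _ _ fun _ => rfl] at hm ⊢
    omega
  refine Nat.card_le_card_of_injective
    (fun m : {m : Fin N →₀ ℕ | (m.sum fun _ e => e) ≤ k} => (⟨_, hmem m.1 m.2⟩ :
      Finset.finsuppAntidiag (Finset.univ : Finset (Fin (N + 1))) k)) ?_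
  rintro ⟨m, hm⟩ ⟨m', hm'⟩ h
  have h' := congrArg (fun v => Finsupp.tail v.1) h
  simpa using h'

/-- The polynomial `⟨v, x⟩ - b`. -/
noncomputable def affinePoly (v : Space N) (b : ℝ) : MvPolynomial (Fin N) ℝ :=
  ∑ i, C (v i) * X i - C b

theorem evalAt_affinePoly (v : Space N) (b : ℝ) (x : Space N) :
    evalAt (affinePoly v b) x = inner ℝ v x - b := by
  simp [evalAt, affinePoly, PiLp.inner_apply, mul_comm]

theorem totalDegree_affinePoly_le (v : Space N) (b : ℝ) : (affinePoly v b).totalDegree ≤ 1 := by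
  refine (totalDegree_sub _ _).trans (max_le ?_ (by simp))
  refine totalDegree_finsetSum_le fun i _ => ?_
  refine (totalDegree_mul _ _).trans ?_
  simp

/-- The product of the affine polynomials which define the hyperplanes with index in `I`. -/
noncomputable def facePoly (n : Fin d → Space N) (c : Fin d → ℝ) (I : Finset (Fin d)) :
    MvPolynomial (Fin N) ℝ :=
  ∏ i ∈ I, affinePoly (n i) (c i)

theorem evalAt_facePoly (n : Fin d → Space N) (c : Fin d → ℝ) (I : Finset (Fin d)) (x : Space N) :
    evalAt (facePoly n c I) x = ∏ i ∈ I, (inner ℝ (n i) x - c i) := by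
  simp only [← evalAt_affinePoly]
  simp [evalAt, facePoly, map_prod]

theorem totalDegree_facePoly_le (n : Fin d → Space N) (c : Fin d → ℝ) (I : Finset (Fin d)) :
    (facePoly n c I).totalDegree ≤ I.card := by
  refine (totalDegree_finsetProd _ _).trans ?_
  refine (Finset.sum_le_sum fun i _ => totalDegree_affinePoly_le (n i) (c i)).trans ?_
  simp

theorem evalAt_add (p q : MvPolynomial (Fin N) ℝ) (x : Space N) :
    evalAt (p + q) x = evalAt p x + evalAt q x := by simp [evalAt]

theorem evalAt_sub (p q : MvPolynomial (Fin N) ℝ) (x : Space N) :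
    evalAt (p - q) x = evalAt p x - evalAt q x := by simp [evalAt]

theorem evalAt_sum {κ : Type*} (s : Finset κ) (p : κ → MvPolynomial (Fin N) ℝ) (x : Space N) :
    evalAt (∑ i ∈ s, p i) x = ∑ i ∈ s, evalAt (p i) x := by simp [evalAt]

theorem evalAt_C_mul (a : ℝ) (p : MvPolynomial (Fin N) ℝ) (x : Space N) :
    evalAt (C a * p) x = a * evalAt p x := by simp [evalAt]

theorem C_mul_mem_restrictTotalDegree {k : ℕ} (a : ℝ) {p : MvPolynomial (Fin N) ℝ}
    (hp : p.totalDegree ≤ k) : C a * p ∈ restrictTotalDegree (Fin N) ℝ k := by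
  rw [C_mul']
  exact Submodule.smul_mem _ _ ((mem_restrictTotalDegree _ _ _).2 hp)

theorem inner_eq_of_mem_flat {n : Fin d → Space N} {c : Fin d → ℝ} {H : Finset (Fin d)}
    {x : Space N} : x ∈ flat n c H ↔ ∀ i ∈ H, inner ℝ (n i) x = c i := by
  simp [flat, hyperplane]

/-- A vertex lies on no other hyperplanes than those which define it. -/
theorem inner_vertex_eq_iff {n : Fin d → Space N} {c : Fin d → ℝ} (hN : 0 < N)
    (hgen : InGeneralPosition n c) {H : Finset (Fin d)} (hH : H.card = N) {x : Space N}
    (hx : x ∈ flat n c H) (i : Fin d) : inner ℝ (n i) x = c i ↔ i ∈ H := by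
  classical
  refine ⟨fun hi => ?_, inner_eq_of_mem_flat.1 hx i⟩
  by_contra hiH
  obtain ⟨j, hj⟩ : H.Nonempty := Finset.card_pos.1 (hH ▸ hN)
  -- Exchanging one hyperplane of `H` for the extra one would give a second N-family through the
  -- same point.
  set H' := insert i (H.erase j) with hH'
  have hcard : H'.card = N := by
    rw [hH', Finset.card_insert_of_notMem (fun h => hiH (Finset.mem_of_mem_erase h)),
      Finset.card_erase_of_mem hj, hH]
    omega
  have hx' : x ∈ flat n c H' := by
    rw [inner_eq_of_mem_flat] at hx ⊢
    intro l hl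
    rcases Finset.mem_insert.1 hl with rfl | hl
    · exact hi
    · exact hx l (Finset.mem_of_mem_erase hl)
  obtain ⟨y, hy⟩ := hgen.meet_in_point H hH
  obtain ⟨y', hy'⟩ := hgen.meet_in_point H' hcard
  have hxy : x = y := by rw [hy] at hx; exact hx
  have hxy' : x = y' := by rw [hy'] at hx'; exact hx'
  have heq : H = H' := hgen.points_distinct hH hcard (by rw [hy, hy', ← hxy, ← hxy'])
  exact hiH (heq ▸ Finset.mem_insert_self i _)

theorem finrank_restrictTotalDegree_le (N k : ℕ) :
    Module.finrank ℝ (restrictTotalDegree (Fin N) ℝ k) ≤ (N + k).choose k := by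
  refine le_trans (le_of_eq ?_) (card_degree_le N k)
  exact Module.finrank_eq_nat_card_basis
    (basisRestrictSupport ℝ {m : Fin N →₀ ℕ | (m.sum fun _ e => e) ≤ k})

/-- The Chung-Yao lattice is an interpolation lattice. -/
theorem isInterpolationLattice_lattice {n : Fin d → Space N} {c : Fin d → ℝ} (hN : 0 < N)
    (hd : N ≤ d) (hgen : InGeneralPosition n c) :
    IsInterpolationLattice (d - N) (lattice n c) := by
  classical
  choose! ϑ hϑ using hgen.meet_in_point
  have hmem {H : Finset (Fin d)} (hH : H.card = N) : ϑ H ∈ flat n c H := by simp [hϑ H hH]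
  let A := {H : Finset (Fin d) // H.card = N}
  let ev : restrictTotalDegree (Fin N) ℝ (d - N) →ₗ[ℝ] (A → ℝ) :=
    { toFun := fun p H => evalAt p.1 (ϑ H.1)
      map_add' := fun p q => by ext H; simp [evalAt]
      map_smul' := fun a p => by ext H; simp [evalAt, smul_eval] }
  have hsurj : Function.Surjective ev := by
    intro y
    have hne (H : A) : evalAt (facePoly n c H.1ᶜ) (ϑ H.1) ≠ 0 := by
      rw [evalAt_facePoly, Finset.prod_ne_zero_iff]
      intro i hi h0
      exact (Finset.mem_compl.1 hi)
        ((inner_vertex_eq_iff hN hgen H.2 (hmem H.2) i).1 (sub_eq_zero.1 h0))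
    -- Lagrange basis: the product over the d - N hyperplanes outside H vanishes at every vertex but
    -- that of H.
    refine ⟨⟨∑ H : A, C (y H / evalAt (facePoly n c H.1ᶜ) (ϑ H.1)) * facePoly n c H.1ᶜ, ?_⟩, ?_⟩
    · refine Submodule.sum_mem _ fun H _ => C_mul_mem_restrictTotalDegree _ ?_
      refine (totalDegree_facePoly_le _ _ _).trans ?_
      rw [Finset.card_compl, H.2, Fintype.card_fin]
    · ext H
      change evalAt _ _ = _
      rw [evalAt_sum, Finset.sum_eq_single H]
      · rw [evalAt_C_mul, div_mul_cancel₀ _ (hne H)]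
      · intro H' _ hH'
        obtain ⟨i, hi, hi'⟩ : ∃ i ∈ H.1, i ∉ H'.1 := by
          by_contra! hcon
          exact hH' (Subtype.ext (Finset.eq_of_subset_of_card_le hcon (H'.2.trans H.2.symm).le).symm)
        rw [evalAt_C_mul, evalAt_facePoly (x := ϑ H.1) (I := H'.1ᶜ),
          Finset.prod_eq_zero (f := fun i => inner ℝ (n i) (ϑ H.1) - c i)
            (Finset.mem_compl.2 hi'), mul_zero]
        rw [inner_eq_of_mem_flat.1 (hmem H.2) i hi, sub_self]
      · simp
  have hA : Module.finrank ℝ (A → ℝ) = d.choose N := by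
    rw [Module.finrank_fintype_fun_eq_card, Fintype.card_finset_len, Fintype.card_fin]
  have hfin : Module.finrank ℝ (restrictTotalDegree (Fin N) ℝ (d - N)) = Module.finrank ℝ (A → ℝ) := by
    refine le_antisymm ?_ (LinearMap.finrank_le_finrank_of_surjective hsurj)
    rw [hA]
    refine (finrank_restrictTotalDegree_le _ _).trans ?_
    rw [Nat.add_sub_cancel' hd, Nat.choose_symm hd]
  -- Surjectivity and the count of monomials force equal dimensions, so uniqueness follows from
  -- existence.
  have hinj : Function.Injective ev :=
    (LinearMap.injective_iff_surjective_of_finrank_eq_finrank hfin).2 hsurj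
  have hlat (f : Space N → ℝ) (p : MvPolynomial (Fin N) ℝ) :
      (∀ a ∈ lattice n c, evalAt p a = f a) ↔ ∀ H : A, evalAt p (ϑ H.1) = f (ϑ H.1) := by
    constructor
    · exact fun h H => h _ ⟨H.1, H.2, hmem H.2⟩
    · rintro h a ⟨H, hH, ha⟩
      rw [hϑ H hH] at ha
      rw [Set.mem_singleton_iff.1 ha]
      exact h ⟨H, hH⟩
  intro f
  obtain ⟨p, hp⟩ := hsurj fun H => f (ϑ H.1)
  refine ⟨p.1, ⟨p.2, (hlat f p.1).2 fun H => congrFun hp H⟩, ?_⟩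
  rintro q ⟨hq, hqf⟩
  have : ev ⟨q, hq⟩ = ev p := by
    rw [hp]
    ext H
    exact (hlat f q).1 hqf H
  exact congrArg Subtype.val (hinj this)

/-- The Taylor polynomial is a polynomial of degree at most its order. -/
theorem exists_evalAt_eq_taylorAtZero (k : ℕ) (f : Space N → ℝ) :
    ∃ q ∈ restrictTotalDegree (Fin N) ℝ k, ∀ x, evalAt q x = taylorAtZero k f x := by
  classical
  have hform (j : ℕ) (hj : j ≤ k) (T : ContinuousMultilinearMap ℝ (fun _ : Fin j => Space N) ℝ) :
      ∃ q ∈ restrictTotalDegree (Fin N) ℝ k, ∀ x, evalAt q x = T (fun _ => x) := by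
    let e : Fin N → Space N := fun i => EuclideanSpace.single i 1
    refine ⟨∑ σ : Fin j → Fin N, C (T fun l => e (σ l)) * ∏ l, X (σ l), ?_, fun x => ?_⟩
    · refine Submodule.sum_mem _ fun σ _ => C_mul_mem_restrictTotalDegree _ ?_
      refine (totalDegree_finsetProd _ _).trans ?_
      simpa using hj
    · have hx : x = ∑ i, x i • e i := by
        ext i
        simp [e, Finset.sum_apply, Pi.single_apply]
      have hT : T (fun _ => x) = T (fun _ => ∑ i, x i • e i) := by rw [← hx]
      rw [hT, ContinuousMultilinearMap.map_sum, evalAt_sum]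
      refine Finset.sum_congr rfl fun σ _ => ?_
      rw [ContinuousMultilinearMap.map_smul_univ, evalAt_C_mul]
      simp [evalAt, map_prod, mul_comm]
  have hterm (j : ℕ) : ∃ q ∈ restrictTotalDegree (Fin N) ℝ k,
      j ≤ k → ∀ x, evalAt q x = iteratedFDeriv ℝ j f 0 (fun _ => x) := by
    by_cases hj : j ≤ k
    · obtain ⟨q, hq, h⟩ := hform j hj (iteratedFDeriv ℝ j f 0)
      exact ⟨q, hq, fun _ => h⟩
    · exact ⟨0, Submodule.zero_mem _, fun h => absurd h hj⟩
  choose q hq hqx using hterm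
  refine ⟨∑ j ∈ Finset.range (k + 1), C ((j.factorial : ℝ))⁻¹ * q j,
    Submodule.sum_mem _ fun j _ => C_mul_mem_restrictTotalDegree _
      ((mem_restrictTotalDegree _ _ _).1 (hq j)), fun x => ?_⟩
  rw [evalAt_sum, taylorAtZero]
  refine Finset.sum_congr rfl fun j hj => ?_
  rw [evalAt_C_mul, hqx j (Nat.lt_succ_iff.1 (Finset.mem_range.1 hj))]

end Polynomials

/-! ### Newton form of the interpolant and its bound. -/

section Newton

variable {N d : ℕ}

theorem iteratedDeriv_comp_line {m : ℕ} {g : Space N → ℝ} (hg : ContDiff ℝ m g) (a u : Space N)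
    (ξ : ℝ) : iteratedDeriv m (fun t : ℝ => g (a + t • u)) ξ
      = iteratedFDeriv ℝ m g (a + ξ • u) (fun _ => u) := by
  set L : ℝ →L[ℝ] Space N := ContinuousLinearMap.toSpanSingleton ℝ u with hL
  have hga : ContDiff ℝ m fun z => g (a + z) := hg.comp (contDiff_const.add contDiff_id)
  have h := L.iteratedFDeriv_comp_right hga ξ (i := m) le_rfl
  rw [iteratedFDeriv_comp_add_left] at h
  have hfun : (fun t : ℝ => g (a + t • u)) = (fun z => g (a + z)) ∘ L := by
    ext t
    simp [hL]
  rw [iteratedDeriv_eq_iteratedFDeriv, hfun, h]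
  simp [hL]

/-- The restriction of a polynomial to a line. -/
theorem exists_polynomial_on_line {k : ℕ} {p : MvPolynomial (Fin N) ℝ} (hp : p.totalDegree ≤ k)
    (a u : Space N) :
    ∃ q : Polynomial ℝ, q.natDegree ≤ k ∧ ∀ t : ℝ, q.eval t = evalAt p (a + t • u) := by
  refine ⟨MvPolynomial.aeval
    (fun i => Polynomial.C (a i) + Polynomial.X * Polynomial.C (u i)) p, ?_, fun t => ?_⟩
  · refine (MvPolynomial.aeval_natDegree_le p hp _ (n := 1) fun i => ?_).trans (by simp)
    compute_degree
  · rw [evalAt, ← Polynomial.coe_evalRingHom, MvPolynomial.aeval_def,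
      MvPolynomial.hom_eval₂, MvPolynomial.eval, MvPolynomial.coe_eval₂Hom]
    congr 1
    · ext x
      simp
    · ext i
      simp
      ring

/-- The interpolation error on a line, compared with the product of the affine functions which
vanish at the nodes. -/
theorem abs_sub_evalAt_le_on_line {n : Fin d → Space N} {c : Fin d → ℝ} {I : Finset (Fin d)}
    {k : ℕ} (hI : I.card = k + 1) {g : Space N → ℝ} (hg : ContDiff ℝ (k + 1 : ℕ) g)
    {p : MvPolynomial (Fin N) ℝ} (hp : p.totalDegree ≤ k) {a u : Space N} (hu : ‖u‖ ≤ 1)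
    {δ r M : ℝ} (hδ : 0 < δ) (hIδ : ∀ i ∈ I, δ ≤ |inner ℝ (n i) u|)
    (ha : a ∈ Metric.closedBall 0 r) {y : Fin d → Space N}
    (hy : ∀ i, y i = a + ((c i - inner ℝ (n i) a) / inner ℝ (n i) u) • u)
    (hyr : ∀ i ∈ I, y i ∈ Metric.closedBall 0 r) (hyinj : Set.InjOn y I)
    (hya : ∀ i ∈ I, y i ≠ a) (hyp : ∀ i ∈ I, evalAt p (y i) = g (y i))
    (hM : ∀ b ∈ Metric.closedBall (0 : Space N) r, ‖iteratedFDeriv ℝ (k + 1) g b‖ ≤ M) :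
    |g a - evalAt p a| ≤ M / δ ^ (k + 1) * |evalAt (facePoly n c I) a| := by
  set t : Fin d → ℝ := fun i => (c i - inner ℝ (n i) a) / inner ℝ (n i) u with ht
  have hM0 : 0 ≤ M := (norm_nonneg _).trans (hM a ha)
  obtain ⟨q, hq, hqt⟩ := exists_polynomial_on_line hp a u
  set G : ℝ → ℝ := fun s => g (a + s • u) with hG
  have hGc : ContDiff ℝ I.card G := by
    rw [hI]
    exact hg.comp (contDiff_const.add (contDiff_id.smul contDiff_const))
  -- The parameters staying in the ball form an interval, so the intermediate point ξ of the error
  -- formula lies where M bounds the derivative.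
  set s : Set ℝ := {z | a + z • u ∈ Metric.closedBall (0 : Space N) r} with hs
  have hsconv : Convex ℝ s := by
    intro z hz w hw α β hα hβ hαβ
    have := convex_closedBall (0 : Space N) r hz hw hα hβ hαβ
    have heq : α • (a + z • u) + β • (a + w • u) = a + (α • z + β • w) • u := by
      have : a = (α + β) • a := by rw [hαβ, one_smul]
      conv_rhs => rw [this]
      simp only [smul_eq_mul]
      module
    rw [heq] at this
    exact this
  obtain ⟨ξ, hξ, herr⟩ := exists_interpolation_error_eq hsconv.ordConnected hGc
    (t := t) (q := q) (τ := 0)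
    (fun i hi j hj hij => hyinj hi hj (by rw [hy i, hy j]; exact congrArg (fun z => a + z • u) hij))
    (by
      rw [hI]
      refine (Polynomial.degree_le_of_natDegree_le hq).trans_lt ?_
      exact_mod_cast Nat.lt_succ_self k)
    (fun i hi => by
      have := hyp i hi
      rw [hy i] at this
      rw [hqt]
      exact this)
    (fun i hi h0 => hya i hi (by
      rw [hy i]
      change a + t i • u = a
      rw [h0, zero_smul, add_zero]))
    (fun i hi => by
      have := hyr i hi
      rw [hy i] at this
      exact this)
    (by simpa [hs] using ha)
  have hG0 : G 0 - q.eval 0 = g a - evalAt p a := by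
    rw [hqt, hG]
    simp
  rw [← hG0, herr, abs_mul, evalAt_facePoly, Finset.abs_prod, Finset.abs_prod]
  have hder : |iteratedDeriv I.card G ξ / (I.card.factorial : ℝ)| ≤ M := by
    rw [hI, hG, iteratedDeriv_comp_line hg, abs_div, Nat.abs_cast]
    refine (div_le_self (abs_nonneg _)
      (Nat.one_le_cast.2 (Nat.factorial_pos (k + 1)))).trans ?_
    rw [← Real.norm_eq_abs]
    refine (ContinuousMultilinearMap.le_opNorm _ _).trans ?_
    rw [Finset.prod_const]
    refine (mul_le_of_le_one_right (norm_nonneg _) (pow_le_one₀ (norm_nonneg _) hu)).trans ?_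
    exact hM _ hξ
  -- The line meets hyperplane i at parameter t i, which is minus the affine form at a divided by ⟨n
  -- i, u⟩, and |⟨n i, u⟩| ≥ δ.
  have hprod : ∏ i ∈ I, |0 - t i| ≤ (∏ i ∈ I, |inner ℝ (n i) a - c i|) / δ ^ (k + 1) := by
    rw [← hI, ← Finset.prod_const, ← Finset.prod_div_distrib]
    refine Finset.prod_le_prod (fun _ _ => abs_nonneg _) fun i hi => ?_
    rw [zero_sub, abs_neg, ht, abs_div, abs_sub_comm]
    exact div_le_div_of_nonneg_left (abs_nonneg _) hδ (hIδ i hi)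
  refine (mul_le_mul hder hprod (Finset.prod_nonneg fun _ _ => abs_nonneg _) hM0).trans ?_
  rw [mul_div_assoc', div_mul_eq_mul_div]

/-- The constant in the bound of the Newton form of the interpolation polynomial. -/
noncomputable def newtonConst (N : ℕ) (R δ : ℝ) : ℕ → ℝ
  | 0 => 1
  -- One term for each choice of N - 1 among N + k old hyperplanes: (2R)^(k+1) bounds the face
  -- product, δ^(-(k+1)) comes from its coefficient.
  | k + 1 => newtonConst N R δ k + (N + k).choose (N - 1) * ((2 * R) / δ) ^ (k + 1)

theorem newtonConst_nonneg {R δ : ℝ} (hR : 0 ≤ R) (hδ : 0 < δ) (k : ℕ) :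
    0 ≤ newtonConst N R δ k := by
  induction k with
  | zero => exact zero_le_one
  | succ k ih => exact add_nonneg ih (by positivity)

theorem abs_evalAt_facePoly_le {n : Fin d → Space N} {c : Fin d → ℝ} (hunit : ∀ i, ‖n i‖ = 1)
    {R : ℝ} (hc : ∀ i, |c i| ≤ R) (I : Finset (Fin d)) {x : Space N}
    (hx : x ∈ Metric.closedBall 0 R) : |evalAt (facePoly n c I) x| ≤ (2 * R) ^ I.card := by
  rw [evalAt_facePoly, Finset.abs_prod, ← Finset.prod_const]
  refine Finset.prod_le_prod (fun _ _ => abs_nonneg _) fun i _ => ?_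
  have h1 : |inner ℝ (n i) x| ≤ R := by
    refine (abs_real_inner_le_norm _ _).trans ?_
    rw [hunit, one_mul]
    simpa using hx
  have h2 := abs_sub (inner ℝ (n i) x) (c i)
  linarith [hc i]

/-- The interpolation polynomial of a smooth function at a Chung-Yao lattice, in Newton form,
bounded by the derivatives of the function. -/
theorem exists_interpolant_bound {n : Fin d → Space N} {c : Fin d → ℝ} (hN : 0 < N)
    (hunit : ∀ i, ‖n i‖ = 1) (hgen : InGeneralPosition n c) {ϑ : Finset (Fin d) → Space N}
    (hϑ : ∀ H : Finset (Fin d), H.card = N → flat n c H = {ϑ H}) {r R δ : ℝ} (hδ : 0 < δ)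
    (hc : ∀ i, |c i| ≤ R)
    (hϑr : ∀ H : Finset (Fin d), H.card = N → ϑ H ∈ Metric.closedBall 0 r)
    (hvol : ∀ i : Fin N ↪o Fin d, δ ≤ vol (fun j => n (i j)))
    {g : Space N → ℝ} {M : ℝ} (k : ℕ) (hg : ContDiff ℝ k g)
    (hM : ∀ j ≤ k, ∀ a ∈ Metric.closedBall (0 : Space N) r, ‖iteratedFDeriv ℝ j g a‖ ≤ M)
    (S : Finset (Fin d)) (hS : S.card = N + k) :
    ∃ p : MvPolynomial (Fin N) ℝ, p.totalDegree ≤ k ∧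
      (∀ H ⊆ S, H.card = N → evalAt p (ϑ H) = g (ϑ H)) ∧
      ∀ x ∈ Metric.closedBall (0 : Space N) R, |evalAt p x| ≤ newtonConst N R δ k * M := by
  classical
  have hmem {H : Finset (Fin d)} (hH : H.card = N) : ϑ H ∈ flat n c H := by simp [hϑ H hH]
  induction k generalizing S with
  | zero =>
    have hSN : S.card = N := by omega
    refine ⟨MvPolynomial.C (g (ϑ S)), by simp, fun H hHS hH => ?_, fun x _ => ?_⟩
    · rw [Finset.eq_of_subset_of_card_le hHS (hSN.trans hH.symm).le]
      simp [evalAt]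
    · have := hM 0 le_rfl _ (hϑr S hSN)
      rw [norm_iteratedFDeriv_zero] at this
      simpa [evalAt, newtonConst] using this
  | succ k ih =>
    obtain ⟨e, he⟩ : S.Nonempty := Finset.card_pos.1 (by omega)
    set S' := S.erase e with hS'
    have hS'card : S'.card = N + k := by rw [hS', Finset.card_erase_of_mem he]; omega
    have heS' : e ∉ S' := Finset.notMem_erase e S
    obtain ⟨p, hp, hpint, hpbound⟩ := ih (hg.of_le (by norm_cast; omega))
      (fun j hj => hM j (by omega)) S' hS'card
    set 𝒦 := S'.powersetCard (N - 1) with h𝒦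
    set face : Finset (Fin d) → MvPolynomial (Fin N) ℝ := fun K => facePoly n c (S' \ K) with hface
    set v : Finset (Fin d) → Space N := fun K => ϑ (insert e K) with hv
    -- Forced by interpolation at the new vertex v K, where every other face product vanishes.
    set α : Finset (Fin d) → ℝ :=
      fun K => (g (v K) - evalAt p (v K)) / evalAt (face K) (v K) with hα
    have h𝒦mem {K : Finset (Fin d)} (hK : K ∈ 𝒦) : K ⊆ S' ∧ K.card + 1 = N := by
      have := Finset.mem_powersetCard.1 hK
      exact ⟨this.1, by omega⟩
    have hins {K : Finset (Fin d)} (hK : K ∈ 𝒦) {i : Fin d} (hi : i ∉ K) :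
        (insert i K).card = N := by
      rw [Finset.card_insert_of_notMem hi]
      exact (h𝒦mem hK).2
    have heK {K : Finset (Fin d)} (hK : K ∈ 𝒦) : e ∉ K := fun h => heS' ((h𝒦mem hK).1 h)
    have hdiff {K : Finset (Fin d)} (hK : K ∈ 𝒦) : (S' \ K).card = k + 1 := by
      have := h𝒦mem hK
      rw [Finset.card_sdiff_of_subset this.1]
      omega
    have hface0 {K : Finset (Fin d)} (hK : K ∈ 𝒦) : evalAt (face K) (v K) ≠ 0 := by
      rw [hface, evalAt_facePoly, Finset.prod_ne_zero_iff]
      intro i hi h0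
      rw [Finset.mem_sdiff] at hi
      have := (inner_vertex_eq_iff hN hgen (hins hK (heK hK)) (hmem (hins hK (heK hK))) i).1
        (sub_eq_zero.1 h0)
      rcases Finset.mem_insert.1 this with rfl | h
      · exact heS' hi.1
      · exact hi.2 h
    have hfacezero {K H : Finset (Fin d)} (hH : H.card = N) {i : Fin d} (hiH : i ∈ H)
        (hiS : i ∈ S') (hiK : i ∉ K) : evalAt (face K) (ϑ H) = 0 := by
      rw [hface, evalAt_facePoly]
      refine Finset.prod_eq_zero (Finset.mem_sdiff.2 ⟨hiS, hiK⟩) ?_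
      rw [inner_eq_of_mem_flat.1 (hmem hH) i hiH, sub_self]
    have hαbound {K : Finset (Fin d)} (hK : K ∈ 𝒦) : |α K| ≤ M / δ ^ (k + 1) := by
      obtain ⟨u, hu1, huK, huδ⟩ := exists_line_direction hunit hvol (h𝒦mem hK).2
      -- For i in S' \ K these are the k + 1 old vertices on the line of K; its intersection with
      -- the new hyperplane e is v K.
      set y : Fin d → Space N :=
        fun i => v K + ((c i - inner ℝ (n i) (v K)) / inner ℝ (n i) u) • u with hy
      have hyϑ (i : Fin d) (hi : i ∈ S' \ K) : y i = ϑ (insert i K) := by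
        have hiK := (Finset.mem_sdiff.1 hi).2
        have hne : inner ℝ (n i) u ≠ 0 := by
          intro h0
          have := huδ i hiK
          rw [h0, abs_zero] at this
          linarith
        have : y i ∈ flat n c (insert i K) := by
          rw [inner_eq_of_mem_flat]
          intro j hj
          rw [hy, inner_add_right, real_inner_smul_right]
          rcases Finset.mem_insert.1 hj with rfl | hjK
          · field_simp
            ring
          · rw [huK j hjK, mul_zero, add_zero]
            exact inner_eq_of_mem_flat.1 (hmem (hins hK (heK hK))) j
              (Finset.mem_insert_of_mem hjK)
        rw [hϑ _ (hins hK hiK)] at this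
        exact this
      have hϑinj {H H' : Finset (Fin d)} (hH : H.card = N) (hH' : H'.card = N)
          (h : ϑ H = ϑ H') : H = H' :=
        hgen.points_distinct hH hH' (by rw [hϑ H hH, hϑ H' hH', h])
      have hinsinj {i j : Fin d} (hi : i ∉ K) (h : insert i K = insert j K) : i = j := by
        have : i ∈ insert j K := h ▸ Finset.mem_insert_self i K
        exact (Finset.mem_insert.1 this).resolve_right hi
      have hline := abs_sub_evalAt_le_on_line (hdiff hK) hg hp hu1 hδ
        (fun i hi => huδ i (Finset.mem_sdiff.1 hi).2) (hϑr _ (hins hK (heK hK))) (y := y)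
        (fun i => rfl)
        (fun i hi => by
          rw [hyϑ i hi]
          exact hϑr _ (hins hK (Finset.mem_sdiff.1 hi).2))
        (fun i hi j hj hij => by
          rw [hyϑ i hi, hyϑ j hj] at hij
          have hi' := (Finset.mem_sdiff.1 hi).2
          have hj' := (Finset.mem_sdiff.1 hj).2
          exact hinsinj hi' (hϑinj (hins hK hi') (hins hK hj') hij))
        (fun i hi hia => by
          rw [hyϑ i hi] at hia
          have hi' := Finset.mem_sdiff.1 hi
          have := hinsinj hi'.2 (hϑinj (hins hK hi'.2) (hins hK (heK hK)) hia)
          exact heS' (this ▸ hi'.1))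
        (fun i hi => by
          rw [hyϑ i hi]
          have hi' := Finset.mem_sdiff.1 hi
          exact hpint _ (Finset.insert_subset hi'.1 (h𝒦mem hK).1) (hins hK hi'.2))
        (hM (k + 1) le_rfl)
      rw [hα, abs_div, div_le_iff₀ (abs_pos.2 (hface0 hK))]
      exact hline
    refine ⟨p + ∑ K ∈ 𝒦, MvPolynomial.C (α K) * face K, ?_, fun H hHS hH => ?_, fun x hx => ?_⟩
    · rw [← MvPolynomial.mem_restrictTotalDegree]
      refine Submodule.add_mem _ ((MvPolynomial.mem_restrictTotalDegree _ _ _).2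
        (hp.trans (Nat.le_succ k))) (Submodule.sum_mem _ fun K hK => ?_)
      exact C_mul_mem_restrictTotalDegree _ ((totalDegree_facePoly_le _ _ _).trans (hdiff hK).le)
    · rw [evalAt_add, evalAt_sum]
      by_cases heH : e ∈ H
      · have hK₀ : H.erase e ∈ 𝒦 := Finset.mem_powersetCard.2
          ⟨Finset.erase_subset_erase e hHS, by rw [Finset.card_erase_of_mem heH, hH]⟩
        have hvK₀ : v (H.erase e) = ϑ H := by rw [hv]; simp only [Finset.insert_erase heH]
        rw [Finset.sum_eq_single_of_mem _ hK₀, evalAt_C_mul, ← hvK₀]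
        · rw [div_mul_cancel₀ _ (hface0 hK₀)]
          ring
        · intro K hK hne
          obtain ⟨i, hi, hiK⟩ : ∃ i ∈ H.erase e, i ∉ K := by
            by_contra! hcon
            refine hne (Finset.eq_of_subset_of_card_le hcon ?_).symm
            rw [(Finset.mem_powersetCard.1 hK).2, (Finset.mem_powersetCard.1 hK₀).2]
          rw [evalAt_C_mul, hfacezero hH (Finset.mem_of_mem_erase hi)
            (Finset.erase_subset_erase e hHS hi) hiK, mul_zero]
      -- At an old vertex every correction vanishes: H has N elements and K only N - 1, so some
      -- hyperplane of H lies outside K.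
      · have hHS' : H ⊆ S' := fun i hi => Finset.mem_erase.2 ⟨fun h => heH (h ▸ hi), hHS hi⟩
        rw [Finset.sum_eq_zero, add_zero, hpint H hHS' hH]
        intro K hK
        obtain ⟨i, hi, hiK⟩ : ∃ i ∈ H, i ∉ K := by
          by_contra! hcon
          have := Finset.card_le_card hcon
          have := (h𝒦mem hK).2
          omega
        rw [evalAt_C_mul, hfacezero hH hi (hHS' hi) hiK, mul_zero]
    · rw [evalAt_add, evalAt_sum]
      have hterm : ∀ K ∈ 𝒦, |evalAt (MvPolynomial.C (α K) * face K) x|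
          ≤ M / δ ^ (k + 1) * (2 * R) ^ (k + 1) := by
        intro K hK
        rw [evalAt_C_mul, abs_mul]
        have hb := abs_evalAt_facePoly_le hunit hc (S' \ K) hx
        rw [hdiff hK] at hb
        exact mul_le_mul (hαbound hK) hb (abs_nonneg _) ((abs_nonneg _).trans (hαbound hK))
      have hsum := (Finset.abs_sum_le_sum_abs _ _).trans (Finset.sum_le_sum hterm)
      rw [Finset.sum_const, h𝒦, Finset.card_powersetCard, hS'card, nsmul_eq_mul] at hsum
      refine (abs_add_le _ _).trans ((add_le_add (hpbound x hx) hsum).trans (le_of_eq ?_))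
      rw [newtonConst, div_pow]
      ring

end Newton

/-! ### Localization and comparison with the Taylor polynomial. -/

section Estimate

variable {N d : ℕ}

/-- A function smooth near a closed ball coincides near the ball with a globally smooth one. -/
theorem exists_contDiff_eventuallyEq {m : ℕ} {R : ℝ} (hR : 0 < R) {Ω : Set (Space N)}
    (hΩ : IsOpen Ω) (hball : Metric.closedBall 0 R ⊆ Ω) {f : Space N → ℝ}
    (hf : ContDiffOn ℝ m f Ω) :
    ∃ F : Space N → ℝ, ContDiff ℝ m F ∧
      ∀ a ∈ Metric.closedBall (0 : Space N) R, F =ᶠ[nhds a] f := by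
  obtain ⟨ε, hε, hεΩ⟩ :=
    (isCompact_closedBall (0 : Space N) R).exists_cthickening_subset_open hΩ hball
  rw [cthickening_closedBall hε.le hR.le] at hεΩ
  -- χ equals 1 on a neighbourhood of the ball, so all derivatives agree there, and its support lies
  -- in the ε-thickening inside Ω.
  let χ : ContDiffBump (0 : Space N) := ⟨R + ε / 2, ε + R, by positivity, by linarith⟩
  refine ⟨fun x => χ x * f x, contDiff_iff_contDiffAt.2 fun x => ?_, fun a ha => ?_⟩
  · by_cases hx : x ∈ Ω
    · exact χ.contDiffAt.mul (hf.contDiffAt (hΩ.mem_nhds hx))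
    · have hx' : x ∉ tsupport χ := by
        rw [χ.tsupport_eq]
        exact fun h => hx (hεΩ h)
      have hzero : (fun x => χ x * f x) =ᶠ[nhds x] fun _ => 0 := by
        filter_upwards [notMem_tsupport_iff_eventuallyEq.1 hx'] with z hz
        rw [hz, Pi.zero_apply, zero_mul]
      exact contDiffAt_const.congr_of_eventuallyEq hzero
  · have ha' : a ∈ Metric.ball (0 : Space N) χ.rIn := by
      rw [mem_closedBall_zero_iff] at ha
      rw [mem_ball_zero_iff]
      change ‖a‖ < R + ε / 2
      linarith
    filter_upwards [χ.eventuallyEq_one_of_mem_ball ha'] with z hz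
    rw [hz, Pi.one_apply, one_mul]

theorem interpolates_lagrange {k : ℕ} {A : Set (Space N)} (hA : IsInterpolationLattice k A)
    (f : Space N → ℝ) : Interpolates k A f (lagrange k A f) := by
  have h := (hA f).exists
  rw [lagrange, dif_pos h]
  exact h.choose_spec

/-- With I empty the lattice is nonempty; with I a singleton every hyperplane meets the lattice,
which bounds its constant c i. -/
theorem exists_mem_lattice_of_card_le {n : Fin d → Space N} {c : Fin d → ℝ} (hd : N ≤ d)
    (hgen : InGeneralPosition n c) (I : Finset (Fin d)) (hI : I.card ≤ N) :
    ∃ H : Finset (Fin d), I ⊆ H ∧ H.card = N ∧ ∃ x ∈ lattice n c, x ∈ flat n c H := by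
  obtain ⟨H, hIH, -, hH⟩ := Finset.exists_subsuperset_card_eq (Finset.subset_univ I) hI
    (by simpa using hd)
  obtain ⟨x, hx⟩ := hgen.meet_in_point H hH
  have : x ∈ flat n c H := by simp [hx]
  exact ⟨H, hIH, hH, x, ⟨H, hH, this⟩, this⟩

theorem norm_le_latticeNorm {A : Set (Space N)} {R : ℝ} (hA : A ⊆ Metric.closedBall 0 R)
    {x : Space N} (hx : x ∈ A) : ‖x‖ ≤ latticeNorm A := by
  refine le_csSup ⟨R, ?_⟩ (Set.mem_image_of_mem _ hx)
  rintro _ ⟨y, hy, rfl⟩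
  simpa using hA hy

theorem latticeNorm_le {A : Set (Space N)} {R : ℝ} (hA : A ⊆ Metric.closedBall 0 R)
    (hne : A.Nonempty) : latticeNorm A ≤ R := by
  refine csSup_le (hne.image _) ?_
  rintro _ ⟨y, hy, rfl⟩
  simpa using hA hy

/-- The Lagrange polynomial at a Chung-Yao lattice of a globally smooth function is close to the
Taylor polynomial. -/
theorem abs_lagrange_sub_taylorAtZero_le {n : Fin d → Space N} {c : Fin d → ℝ} (hN : 0 < N)
    (hd : N ≤ d) (hunit : ∀ i, ‖n i‖ = 1) (hgen : InGeneralPosition n c) {δ R M : ℝ} (hδ : 0 < δ)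
    (hvol : ∀ i : Fin N ↪o Fin d, δ ≤ vol (fun j => n (i j)))
    (hlat : lattice n c ⊆ Metric.closedBall 0 R) {f : Space N → ℝ}
    (hf : ContDiff ℝ (d - N + 1 : ℕ) f)
    (hM : ∀ a ∈ Metric.closedBall (0 : Space N) R, ‖iteratedFDeriv ℝ (d - N + 1) f a‖ ≤ M)
    {x : Space N} (hx : x ∈ Metric.closedBall 0 R) :
    |evalAt (lagrange (d - N) (lattice n c) f) x - taylorAtZero (d - N) f x|
      ≤ newtonConst N R δ (d - N) * (max 1 R) ^ (d - N) * (latticeNorm (lattice n c) * M) := by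
  set k := d - N with hk
  set r := latticeNorm (lattice n c) with hrdef
  obtain ⟨-, -, -, x₀, hx₀, -⟩ := exists_mem_lattice_of_card_le hd hgen ∅ (Nat.zero_le _)
  have hr0 : 0 ≤ r := (norm_nonneg _).trans (norm_le_latticeNorm hlat hx₀)
  have hrR : r ≤ R := latticeNorm_le hlat ⟨x₀, hx₀⟩
  have hM0 : 0 ≤ M := (norm_nonneg _).trans (hM x hx)
  have hc (i : Fin d) : |c i| ≤ R := by
    obtain ⟨H, hiH, -, y, hy, hyH⟩ := exists_mem_lattice_of_card_le hd hgen {i}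
      (by simpa using Nat.succ_le_of_lt hN)
    rw [← inner_eq_of_mem_flat.1 hyH i (hiH (Finset.mem_singleton_self i))]
    refine (abs_real_inner_le_norm _ _).trans ?_
    rw [hunit, one_mul]
    exact (norm_le_latticeNorm hlat hy).trans hrR
  choose! ϑ hϑ using hgen.meet_in_point
  have hmem {H : Finset (Fin d)} (hH : H.card = N) : ϑ H ∈ flat n c H := by simp [hϑ H hH]
  have hϑr (H : Finset (Fin d)) (hH : H.card = N) : ϑ H ∈ Metric.closedBall 0 r := by
    rw [mem_closedBall_zero_iff]
    exact norm_le_latticeNorm hlat ⟨H, hH, hmem hH⟩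
  have htaylor : taylorSum k f = taylorAtZero k f := rfl
  set g : Space N → ℝ := f - taylorSum k f with hg
  have hgc : ContDiff ℝ k g :=
    (hf.of_le (by norm_cast; omega)).sub (contDiff_taylorSum k f)
  have hgM (j : ℕ) (hj : j ≤ k) (a : Space N) (ha : a ∈ Metric.closedBall (0 : Space N) r) :
      ‖iteratedFDeriv ℝ j g a‖ ≤ max 1 R ^ k * (r * M) := by
    refine (norm_iteratedFDeriv_sub_taylorSum_le k hf hr0
      (fun b hb => hM b (Metric.closedBall_subset_closedBall hrR hb)) j hj a ha).trans ?_
    have hpow : r ^ (k - j) ≤ max 1 R ^ k :=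
      (pow_le_pow_left₀ hr0 (hrR.trans (le_max_right 1 R)) _).trans
        (pow_le_pow_right₀ (le_max_left 1 R) (Nat.sub_le k j))
    -- As j ≤ k, a factor r splits off; the other powers of r are absorbed in max(1, R)^k.
    rw [show k + 1 - j = (k - j) + 1 by omega, pow_succ]
    calc M * (r ^ (k - j) * r) = r ^ (k - j) * (r * M) := by ring
      _ ≤ _ := mul_le_mul_of_nonneg_right hpow (mul_nonneg hr0 hM0)
  obtain ⟨p, hp, hpint, hpbound⟩ := exists_interpolant_bound hN hunit hgen hϑ hδ hc hϑr hvol k hgc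
    hgM Finset.univ (by rw [Finset.card_univ, Fintype.card_fin]; omega)
  obtain ⟨q, hq, hqx⟩ := exists_evalAt_eq_taylorAtZero (N := N) k f
  have hL := isInterpolationLattice_lattice hN hd hgen
  have hlag := interpolates_lagrange hL f
  -- Both sides interpolate the remainder g in degree k.
  have heq : lagrange k (lattice n c) f - q = p := by
    refine (hL g).unique ⟨Submodule.sub_mem _ hlag.1 hq, fun a ha => ?_⟩
      ⟨(MvPolynomial.mem_restrictTotalDegree _ _ _).2 hp, ?_⟩
    · rw [evalAt_sub, hlag.2 a ha, hqx, hg, htaylor, Pi.sub_apply]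
    · rintro a ⟨H, hH, ha⟩
      rw [hϑ H hH] at ha
      rw [Set.mem_singleton_iff.1 ha]
      exact hpint H (Finset.subset_univ H) hH
  rw [← hqx, ← evalAt_sub, heq, mul_assoc]
  exact hpbound x hx

theorem le_maxOn_closedBall {R : ℝ} {u : Space N → ℝ}
    (hu : ContinuousOn u (Metric.closedBall 0 R)) {a : Space N} (ha : a ∈ Metric.closedBall 0 R) :
    u a ≤ maxOn (Metric.closedBall 0 R) u :=
  le_csSup ((isCompact_closedBall (0 : Space N) R).bddAbove_image hu) (Set.mem_image_of_mem _ ha)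

end Estimate

end ChungYao

/-! ### The main theorem. -/

theorem corollary4p9 (N d : ℕ) (hN : 2 ≤ N) (hd : N ≤ d)
    (n : ℕ → Fin d → ChungYao.Space N) (c : ℕ → Fin d → ℝ)
    (hunit : ∀ s i, ‖n s i‖ = 1)
    (hgen : ∀ s, ChungYao.InGeneralPosition (n s) (c s))
    (hC1 : Filter.Tendsto (fun s => ChungYao.latticeNorm (ChungYao.lattice (n s) (c s)))
      Filter.atTop (nhds 0))
    (hC2 : ∃ δ : ℝ, 0 < δ ∧ ∀ (s : ℕ) (i : Fin N ↪o Fin d),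
      δ ≤ ChungYao.vol (fun j => n s (i j)))
    (R : ℝ) (hR : 0 < R) :
    (∀ s, ChungYao.IsInterpolationLattice (d - N) (ChungYao.lattice (n s) (c s))) ∧
    ∃ C : ℝ, ∀ s : ℕ,
      ChungYao.lattice (n s) (c s) ⊆ Metric.closedBall 0 R →
      ∀ (Ω : Set (ChungYao.Space N)), IsOpen Ω → Metric.closedBall 0 R ⊆ Ω →
      ∀ f : ChungYao.Space N → ℝ, ContDiffOn ℝ ((d - N + 2 : ℕ) : WithTop ℕ∞) f Ω →
        ChungYao.maxOn (Metric.closedBall 0 R) (fun x =>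
            |ChungYao.evalAt
                (ChungYao.lagrange (d - N) (ChungYao.lattice (n s) (c s)) f) x
              - ChungYao.taylorAtZero (d - N) f x|)
          ≤ C * (ChungYao.latticeNorm (ChungYao.lattice (n s) (c s)) *
              (ChungYao.maxOn (Metric.closedBall 0 R)
                  (fun a => ‖iteratedFDeriv ℝ (d - N + 1) f a‖)
                + ChungYao.maxOn (Metric.closedBall 0 R)
                  (fun a => ‖iteratedFDeriv ℝ (d - N + 2) f a‖))) := by
  have hN0 : 0 < N := by omega
  have hL (s : ℕ) := ChungYao.isInterpolationLattice_lattice hN0 hd (hgen s)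
  refine ⟨hL, ?_⟩
  obtain ⟨δ, hδ, hvol⟩ := hC2
  refine ⟨ChungYao.newtonConst N R δ (d - N) * (max 1 R) ^ (d - N), ?_⟩
  intro s hlat Ω hΩ hball f hf
  -- f may be replaced by a globally smooth F: interpolant, Taylor polynomial and derivatives on the
  -- ball depend only on f near the ball.
  obtain ⟨F, hF, hFf⟩ := ChungYao.exists_contDiff_eventuallyEq hR hΩ hball hf
  have h0 : (0 : ChungYao.Space N) ∈ Metric.closedBall (0 : ChungYao.Space N) R := by
    simpa using hR.le
  have hlagr : ChungYao.lagrange (d - N) (ChungYao.lattice (n s) (c s)) F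
      = ChungYao.lagrange (d - N) (ChungYao.lattice (n s) (c s)) f := by
    have h := ChungYao.interpolates_lagrange (hL s) F
    refine ((hL s) f).unique ⟨h.1, fun a ha => ?_⟩ (ChungYao.interpolates_lagrange (hL s) f)
    rw [h.2 a ha, (hFf a (hlat ha)).eq_of_nhds]
  have htaylor : ChungYao.taylorAtZero (d - N) F = ChungYao.taylorAtZero (d - N) f := by
    ext x
    refine Finset.sum_congr rfl fun j _ => ?_
    rw [((hFf 0 h0).iteratedFDeriv ℝ j).eq_of_nhds]
  set M₁ := ChungYao.maxOn (Metric.closedBall 0 R) (fun a => ‖iteratedFDeriv ℝ (d - N + 1) f a‖)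
  set M₂ := ChungYao.maxOn (Metric.closedBall 0 R) (fun a => ‖iteratedFDeriv ℝ (d - N + 2) f a‖)
  have hM₁ (a : ChungYao.Space N) (ha : a ∈ Metric.closedBall (0 : ChungYao.Space N) R) :
      ‖iteratedFDeriv ℝ (d - N + 1) F a‖ ≤ M₁ := by
    rw [((hFf a ha).iteratedFDeriv ℝ _).eq_of_nhds]
    refine ChungYao.le_maxOn_closedBall (u := fun a => ‖iteratedFDeriv ℝ (d - N + 1) f a‖) ?_ ha
    have hcont : Continuous fun a => ‖iteratedFDeriv ℝ (d - N + 1) F a‖ :=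
      (hF.continuous_iteratedFDeriv (by norm_cast; omega)).norm
    refine hcont.continuousOn.congr fun b hb => ?_
    simp only [((hFf b hb).iteratedFDeriv ℝ (d - N + 1)).eq_of_nhds]
  have hM₂ : 0 ≤ M₂ := by
    refine Real.sSup_nonneg ?_
    rintro _ ⟨a, -, rfl⟩
    exact norm_nonneg _
  obtain ⟨-, -, -, x₀, hx₀, -⟩ := ChungYao.exists_mem_lattice_of_card_le hd (hgen s) ∅ (Nat.zero_le _)
  have hr0 := (norm_nonneg _).trans (ChungYao.norm_le_latticeNorm hlat hx₀)
  refine csSup_le (Set.Nonempty.image _ ⟨0, h0⟩) ?_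
  rintro _ ⟨x, hx, rfl⟩
  have h := ChungYao.abs_lagrange_sub_taylorAtZero_le hN0 hd (hunit s) (hgen s) hδ (hvol s) hlat
    (hF.of_le (by norm_cast; omega)) hM₁ hx
  rw [hlagr, htaylor] at h
  refine h.trans (mul_le_mul_of_nonneg_left ?_ ?_)
  -- The estimate holds with `M₁` alone; adding `M₂` only enlarges the bound.
  · exact mul_le_mul_of_nonneg_left (le_add_of_nonneg_right hM₂) hr0
  · exact mul_nonneg (ChungYao.newtonConst_nonneg hR.le hδ _)
      (pow_nonneg (zero_le_one.trans (le_max_left 1 R)) _)
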